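/- Let $G\rightrightarrows Q$ be a Lie groupoid: $G,Q$ are (finite-dimensional) smooth manifolds, the source $\alpha$ and target $\beta:G\to Q$ are smooth submersions, and the multiplication $m:G_2=\{(g,h)\in G\times G:\beta(g)=\alpha(h)\}\to G$, the identity section $\epsilon:Q\to G$ and the inversion $i:G\to G$ are smooth. For $q\in Q$ let $A_qG=\ker T_{\epsilon(q)}\alpha$ be the fibre of its Lie algebroid. For $v\in A_qG$ put $\overleftarrow v(g)=T_{\epsilon(q)}\ell_g(v)$ if $\beta(g)=q$, where $\ell_g(h)=gh$, and $\overrightarrow v(g)=-T_{\epsilon(q)}(r_g\circ i)(v)$ if $\alpha(g)=q$, where $(r_g\circ i)(h)=h^{-1}g$; here $h$ runs through the fibre $\alpha^{-1}(q)$. Let $N\subset G$ be an embedded submanifold and $g\in G$. Let $\mathcal C^2_{g,N}=\{(g_1,g_2)\in G_2\cap(N\times N): g_1g_2=g\}$ be the set of admissible pairs. Assume that $G_2\cap(N\times N)$ is an embedded submanifold of $N\times N$ and that the restriction of $m$ to it has constant rank in an open neighbourhood of $\mathcal C^2_{g,N}$. Let $(g_1,g_2)\in\mathcal C^2_{g,N}$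 and $q=\beta(g_1)=\alpha(g_2)$. Put $$(A_qG)_{(N,g_1,g_2)}=\{v\in A_qG:\overleftarrow v(g_1)\in T_{g_1}N,\ \overrightarrow v(g_2)\in T_{g_2}N\},$$ and let the space of admissible variations be $$T_{(g_1,g_2)}\mathcal C^2_{g,N}=\{(v_1,v_2)\in T_{g_1}N\times T_{g_2}N: T_{g_1}\beta(v_1)=T_{g_2}\alpha(v_2),\ T_{(g_1,g_2)}m(v_1,v_2)=0\}.$$ (a) The map $v\mapsto(\overleftarrow v(g_1),-\overrightarrow v(g_2))$ is a linear isomorphism from $(A_qG)_{(N,g_1,g_2)}$ onto $T_{(g_1,g_2)}\mathcal C^2_{g,N}$. (b) If moreover $G_2$ and $N\times N$ intersect cleanly at $(g_1,g_2)$, i.e. the tangent space of $G_2\cap(N\times N)$ at $(g_1,g_2)$ is $\{(v_1,v_2)\in T_{g_1}N\times T_{g_2}N: T_{g_1}\beta(v_1)=T_{g_2}\alpha(v_2)\}$, then $T_{(g_1,g_2)}\mathcal C^2_{g,N}$ as defined above is the set of velocities at $t=0$ of the smooth curves $(-\delta,\delta)\to G\times G$, $\delta>0$, that lie in $\mathcal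 C^2_{g,N}$ and pass through $(g_1,g_2)$ at $t=0$; that is, it is the geometric tangent space of $\mathcal C^2_{g,N}$, so that the map in (a) is a linear isomorphism onto that tangent space. -/

import Mathlib

open Set Filter Topology
open scoped Manifold ContDiff

noncomputable section

section Submanifolds

variable {E : Type*} [NormedAddCommGroup E] [NormedSpace ℝ E]
  {H : Type*} [TopologicalSpace H] (I : ModelWithCorners ℝ E H)
  {M : Type*} [TopologicalSpace M] [ChartedSpace H M]

/-- `S` is an embedded smooth submanifold of the (boundaryless) manifold `M`: around each of its
points there is a chart of the smooth structure of `M` in which `S` is an affine subspace.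
The dimension may vary from one component of `S` to another. -/
def IsEmbeddedSubmanifold (S : Set M) : Prop :=
  ∀ p ∈ S, ∃ φ ∈ IsManifold.maximalAtlas I ∞ M, p ∈ φ.source ∧
    ∃ W : Submodule ℝ E, ∀ x ∈ φ.source, x ∈ S ↔ φ.extend I x - φ.extend I p ∈ W

/-- The velocities at time `0` of the smooth curves `(-δ, δ) → M` that run in the set `S` and pass
through `p` at time `0`. -/
def curveVelocities (S : Set M) (p : M) : Set (TangentSpace I p) :=
  {v | ∃ (δ : ℝ) (c : ℝ → M), 0 < δ ∧ c 0 = p ∧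
    ContMDiffOn 𝓘(ℝ, ℝ) I ∞ c (Ioo (-δ) δ) ∧ (∀ t ∈ Ioo (-δ) δ, c t ∈ S) ∧
    (mfderiv 𝓘(ℝ, ℝ) I c 0 (1 : ℝ) : E) = v}

/-- The tangent space `T_p S ⊆ T_p M` of a submanifold `S` at its point `p`: the velocities of
smooth curves in `S` through `p`. (For a submanifold these already form a linear subspace; the span
only makes this a subspace by construction.) -/
def tangentSpaceOf (S : Set M) (p : M) : Submodule ℝ (TangentSpace I p) :=
  Submodule.span ℝ (curveVelocities I S p)

end Submanifolds

/-- A Lie groupoid `G ⇉ Q` on smooth manifolds `G`, `Q` modelled on `EG`, `EQ`. The product of `g`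
and `h` is meaningful only if `tgt g = src h`; the values of `mul` on other pairs are irrelevant
(no law speaks about them, and no definition below uses them). Since the set of composable pairs is
an embedded submanifold of `G × G`, smoothness of the product on it is `ContMDiffOn`. -/
structure LieGroupoid (EG EQ : Type*) [NormedAddCommGroup EG] [NormedSpace ℝ EG]
    [NormedAddCommGroup EQ] [NormedSpace ℝ EQ]
    (G Q : Type*) [TopologicalSpace G] [ChartedSpace EG G]
    [TopologicalSpace Q] [ChartedSpace EQ Q] where
  /-- source map `α` -/
  src : G → Q
  /-- target map `β` -/
  tgt : G → Q
  /-- multiplication `m` -/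
  mul : G → G → G
  /-- identity section `ε` -/
  one : Q → G
  /-- inversion `i` -/
  inv : G → G
  src_mul : ∀ g h, tgt g = src h → src (mul g h) = src g
  tgt_mul : ∀ g h, tgt g = src h → tgt (mul g h) = tgt h
  mul_assoc : ∀ g h k, tgt g = src h → tgt h = src k → mul (mul g h) k = mul g (mul h k)
  src_one : ∀ q, src (one q) = q
  tgt_one : ∀ q, tgt (one q) = q
  one_mul : ∀ g, mul (one (src g)) g = g
  mul_one : ∀ g, mul g (one (tgt g)) = g
  src_inv : ∀ g, src (inv g) = tgt g
  tgt_inv : ∀ g, tgt (inv g) = src g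
  mul_inv : ∀ g, mul g (inv g) = one (src g)
  inv_mul : ∀ g, mul (inv g) g = one (tgt g)
  isSubmersion_src : Manifold.IsSubmersion 𝓘(ℝ, EG) 𝓘(ℝ, EQ) ∞ src
  isSubmersion_tgt : Manifold.IsSubmersion 𝓘(ℝ, EG) 𝓘(ℝ, EQ) ∞ tgt
  contMDiffOn_mul : ContMDiffOn (𝓘(ℝ, EG).prod 𝓘(ℝ, EG)) 𝓘(ℝ, EG) ∞
    (fun p : G × G => mul p.1 p.2) {p : G × G | tgt p.1 = src p.2}
  contMDiff_one : ContMDiff 𝓘(ℝ, EQ) 𝓘(ℝ, EG) ∞ one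
  contMDiff_inv : ContMDiff 𝓘(ℝ, EG) 𝓘(ℝ, EG) ∞ inv

namespace LieGroupoid

variable {EG EQ : Type*} [NormedAddCommGroup EG] [NormedSpace ℝ EG]
  [NormedAddCommGroup EQ] [NormedSpace ℝ EQ]
  {G Q : Type*} [TopologicalSpace G] [ChartedSpace EG G]
  [TopologicalSpace Q] [ChartedSpace EQ Q] (Γ : LieGroupoid EG EQ G Q)

/-- The set `G₂` of composable pairs. -/
def composable : Set (G × G) := {p | Γ.tgt p.1 = Γ.src p.2}

/-- `G₂ ∩ (N × N)`. -/
def composableIn (N : Set G) : Set (G × G) := Γ.composable ∩ N ×ˢ N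

/-- The set `C²_{g,N}` of admissible trajectories of length two: the composable pairs of elements
of `N` with product `g`. -/
def admissible (N : Set G) (g : G) : Set (G × G) :=
  {p | p ∈ Γ.composableIn N ∧ Γ.mul p.1 p.2 = g}

/-- The tangent map of the multiplication `m : G₂ → G` at a composable pair `p`. It is the
derivative within `G₂`, and is used only on vectors tangent to `G₂`, where it is uniquely
determined. -/
def tangentMul (p : G × G) :
    TangentSpace (𝓘(ℝ, EG).prod 𝓘(ℝ, EG)) p →L[ℝ] TangentSpace 𝓘(ℝ, EG) (Γ.mul p.1 p.2) :=
  mfderivWithin (𝓘(ℝ, EG).prod 𝓘(ℝ, EG)) 𝓘(ℝ, EG) (fun p : G × G => Γ.mul p.1 p.2)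
    Γ.composable p

/-- The rank at `p` of the restriction of `m` to the submanifold `G₂ ∩ (N × N)`: the dimension of
the image of its tangent space at `p` under the tangent map of `m`. -/
def rankMulOn (N : Set G) (p : G × G) : ℕ :=
  Module.finrank ℝ
    ((tangentSpaceOf (𝓘(ℝ, EG).prod 𝓘(ℝ, EG)) (Γ.composableIn N) p).map
      (Γ.tangentMul p).toLinearMap)

/-- The fibre `A_q G = ker T_{ε(q)} α` of the associated Lie algebroid. -/
def algebroidFiber (q : Q) : Submodule ℝ (TangentSpace 𝓘(ℝ, EG) (Γ.one q)) :=
  LinearMap.ker (mfderiv 𝓘(ℝ, EG) 𝓘(ℝ, EQ) Γ.src (Γ.one q)).toLinearMap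

/-- `v ↦ T_{ε(q)} ℓ_g (v) ∈ T_g G`, the left translate of `v ∈ A_q G`, where `q = β(g)`. The
left translation `ℓ_g(h) = g h` is defined on the fibre `α⁻¹(q)`, so the derivative is the one
within this fibre; on `A_q G`, the tangent space of the fibre, it is uniquely determined. -/
def leftTranslate (q : Q) (g : G) :
    TangentSpace 𝓘(ℝ, EG) (Γ.one q) →L[ℝ] TangentSpace 𝓘(ℝ, EG) g :=
  mfderivWithin 𝓘(ℝ, EG) 𝓘(ℝ, EG) (fun h => Γ.mul g h) (Γ.src ⁻¹' {q}) (Γ.one q)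

/-- `v ↦ -T_{ε(q)} (r_g ∘ i) (v) ∈ T_g G`, the right translate of `v ∈ A_q G`, where `q = α(g)`;
here `(r_g ∘ i)(h) = h⁻¹ g` is defined on the fibre `α⁻¹(q)`. -/
def rightTranslate (q : Q) (g : G) :
    TangentSpace 𝓘(ℝ, EG) (Γ.one q) →L[ℝ] TangentSpace 𝓘(ℝ, EG) g :=
  -(mfderivWithin 𝓘(ℝ, EG) 𝓘(ℝ, EG) (fun h => Γ.mul (Γ.inv h) g) (Γ.src ⁻¹' {q}) (Γ.one q) :
    EG →L[ℝ] EG)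

/-- The subspace `(A_q G)_{(N, g₁, g₂)}` of those `v ∈ A_q G` whose left translate to `g₁` and
right translate to `g₂` are tangent to `N`. -/
def algebroidSubspace (N : Set G) (q : Q) (g₁ g₂ : G) :
    Submodule ℝ (TangentSpace 𝓘(ℝ, EG) (Γ.one q)) :=
  Γ.algebroidFiber q ⊓
    (tangentSpaceOf 𝓘(ℝ, EG) N g₁).comap (Γ.leftTranslate q g₁).toLinearMap ⊓
    (tangentSpaceOf 𝓘(ℝ, EG) N g₂).comap (Γ.rightTranslate q g₂).toLinearMap

/-- The pairs `(v₁, v₂) ∈ T_{g₁} N × T_{g₂} N` with `T β (v₁) = T α (v₂)`. (If `(g₁, g₂)` is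
composable, both sides lie in the same tangent space of `Q`.) -/
def IsComposableVariation (N : Set G) (g₁ g₂ : G)
    (v : TangentSpace (𝓘(ℝ, EG).prod 𝓘(ℝ, EG)) ((g₁, g₂) : G × G)) : Prop :=
  v.1 ∈ tangentSpaceOf 𝓘(ℝ, EG) N g₁ ∧ v.2 ∈ tangentSpaceOf 𝓘(ℝ, EG) N g₂ ∧
    (mfderiv 𝓘(ℝ, EG) 𝓘(ℝ, EQ) Γ.tgt g₁ v.1 : EQ) = mfderiv 𝓘(ℝ, EG) 𝓘(ℝ, EQ) Γ.src g₂ v.2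

/-- The space of variations of the admissible trajectory `(g₁, g₂)`: the pairs
`(v₁, v₂) ∈ T_{g₁} N × T_{g₂} N` with `T β (v₁) = T α (v₂)` and `T m (v₁, v₂) = 0`. -/
def variations (N : Set G) (g₁ g₂ : G) :
    Submodule ℝ (TangentSpace (𝓘(ℝ, EG).prod 𝓘(ℝ, EG)) ((g₁, g₂) : G × G)) where
  carrier := {v | Γ.IsComposableVariation N g₁ g₂ v ∧ Γ.tangentMul (g₁, g₂) v = 0}
  add_mem' := by
    rintro v w ⟨⟨hv1, hv2, hv3⟩, hv4⟩ ⟨⟨hw1, hw2, hw3⟩, hw4⟩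
    refine ⟨⟨add_mem hv1 hw1, add_mem hv2 hw2, ?_⟩, ?_⟩
    · exact (map_add _ v.1 w.1).trans
        ((congrArg₂ (fun a b : EQ => a + b) hv3 hw3).trans (map_add _ v.2 w.2).symm)
    · rw [map_add, hv4, hw4, add_zero]
  zero_mem' := ⟨⟨zero_mem _, zero_mem _, (map_zero _).trans (map_zero _).symm⟩, map_zero _⟩
  smul_mem' := by
    rintro r v ⟨⟨hv1, hv2, hv3⟩, hv4⟩
    refine ⟨⟨Submodule.smul_mem _ r hv1, Submodule.smul_mem _ r hv2, ?_⟩, ?_⟩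
    · exact (map_smul _ r v.1).trans
        ((congrArg (fun a : EQ => r • a) hv3).trans (map_smul _ r v.2).symm)
    · rw [map_smul, hv4, smul_zero]

/-- `G₂` and `N × N` intersect cleanly at `(g₁, g₂)`: the tangent space of the intersection is the
intersection of the tangent spaces. -/
def IntersectsCleanlyAt (N : Set G) (g₁ g₂ : G) : Prop :=
  ∀ v : TangentSpace (𝓘(ℝ, EG).prod 𝓘(ℝ, EG)) ((g₁, g₂) : G × G),
    v ∈ tangentSpaceOf (𝓘(ℝ, EG).prod 𝓘(ℝ, EG)) (Γ.composableIn N) (g₁, g₂) ↔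
      Γ.IsComposableVariation N g₁ g₂ v

end LieGroupoid

end

/-! Both parts come from representing tangent vectors by curves. The tangent maps of the product and
of the translations are derivatives within subsets, so each vector is realised by a curve that stays
in the subset; groupoid identities along curves then become identities between velocities, because a
curve has only one velocity at `0`. The submersion property supplies the curves
(`Manifold.IsSubmersionAt.exists_lift`).

For (a), let `h(t)` run in the source fibre through `ε(q)`. The pair `(g₁ h, h⁻¹ g₂)` is composable
with constant product `g₁ g₂`, so the map lands in the variations (`translates_tangent`). It is
injective since left translation by `g₁` is undone by `g₁⁻¹`. Conversely, `α(ab) = α(a)` shows that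
`Tm(v₁, v₂) = 0` forces `Tα(v₁) = 0`; hence `v₁` is a left translate of some `v`, and injectivity of
left translation identifies `v₂` with the second translate of the same `v` (`exists_translates_eq`).
The submanifold `N` only cuts out matching subspaces on both sides.

For (b), differentiating `ab = g` along curves gives one inclusion. For the other, clean
intersection makes a variation tangent to `G₂ ∩ (N × N)`; in a local parametrization of that
submanifold the product has constant rank, and `exists_curve_in_fiber_of_constant_rank` integrates
every kernel vector to a curve in the fibre. -/

/-! ### Fibres of constant rank maps between vector spaces. -/

section ConstantRank

variable {V F : Type*} [NormedAddCommGroup V] [NormedSpace ℝ V] [FiniteDimensional ℝ V]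
  [NormedAddCommGroup F] [NormedSpace ℝ F] [FiniteDimensional ℝ F]

/-- Choose a linear section of `A` over its range and extend it to all of `F`. -/
theorem ContinuousLinearMap.exists_generalizedInverse (A : V →L[ℝ] F) :
    ∃ B : F →L[ℝ] V, ∀ x, A (B (A x)) = A x := by
  obtain ⟨s, hs⟩ := A.toLinearMap.rangeRestrict.exists_rightInverse_of_surjective
    A.toLinearMap.range_rangeRestrict
  obtain ⟨B, hB⟩ := LinearMap.exists_extend s
  refine ⟨B.toContinuousLinearMap, fun x => ?_⟩
  have h1 : B (A x) = s (A.toLinearMap.rangeRestrict x) :=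
    LinearMap.congr_fun hB (A.toLinearMap.rangeRestrict x)
  have h2 := congrArg Subtype.val (LinearMap.congr_fun hs (A.toLinearMap.rangeRestrict x))
  change A (B (A x)) = A x
  rw [h1]
  exact h2

omit [FiniteDimensional ℝ F] in
/-- If `P ∘ D` has the same rank as `D`, then `P` is injective on the range of `D`. -/
theorem LinearMap.apply_eq_zero_of_finrank_range_comp {F' : Type*} [AddCommGroup F'] [Module ℝ F']
    (D : V →ₗ[ℝ] F) (P : F →ₗ[ℝ] F')
    (h : Module.finrank ℝ (LinearMap.range (P ∘ₗ D)) = Module.finrank ℝ (LinearMap.range D))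
    {x : V} (hx : P (D x) = 0) : D x = 0 := by
  have h1 := (P ∘ₗ D).finrank_range_add_finrank_ker
  have h2 := D.finrank_range_add_finrank_ker
  have hle : LinearMap.ker D ≤ LinearMap.ker (P ∘ₗ D) := fun y hy => by
    simp [LinearMap.mem_ker.1 hy]
  have heq : LinearMap.ker D = LinearMap.ker (P ∘ₗ D) :=
    Submodule.eq_of_le_of_finrank_eq hle (by omega)
  have : x ∈ LinearMap.ker D := heq ▸ (by simpa using hx)
  exact this

/-- If a smooth map `f` has constant rank near `x₀`, every vector in the kernel of its derivative
at `x₀` is the velocity of a smooth curve in the fibre of `f` through `x₀`. -/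
theorem exists_curve_in_fiber_of_constant_rank {f : V → F} {Ω : Set V} (hΩ : IsOpen Ω)
    (hf : ContDiffOn ℝ ∞ f Ω) {x₀ : V} (hx₀ : x₀ ∈ Ω) {r : ℕ}
    (hr : ∀ x ∈ Ω, Module.finrank ℝ (LinearMap.range (fderiv ℝ f x).toLinearMap) = r)
    {v : V} (hv : fderiv ℝ f x₀ v = 0) :
    ∃ (δ : ℝ) (c : ℝ → V), 0 < δ ∧ c 0 = x₀ ∧ ContDiffOn ℝ ∞ c (Ioo (-δ) δ) ∧ HasDerivAt c v 0 ∧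
      ∀ t ∈ Ioo (-δ) δ, c t ∈ Ω ∧ f (c t) = f x₀ := by
  have : CompleteSpace V := FiniteDimensional.complete ℝ V
  have hfat : ∀ x ∈ Ω, ContDiffAt ℝ ∞ f x := fun x hx => hf.contDiffAt (hΩ.mem_nhds hx)
  have hder : ∀ x ∈ Ω, HasFDerivAt f (fderiv ℝ f x) x := fun x hx =>
    ((hfat x hx).differentiableAt (by simp)).hasFDerivAt
  set A := fderiv ℝ f x₀ with hA
  obtain ⟨B, hB⟩ := A.exists_generalizedInverse
  -- `Φ` straightens `f`: its derivative at `x₀` is the identity, and `A B A = A` gives `A ∘ Φ = A ∘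
  -- B ∘ f`. The curve sought is the preimage under `Φ` of the line through `Φ x₀` in direction `v`.
  set Φ : V → V := fun x => x + B (f x - A x) with hΦ
  set Φ' : V → V →L[ℝ] V := fun x => ContinuousLinearMap.id ℝ V + B.comp (fderiv ℝ f x - A) with hΦ'
  have hΦder : ∀ x ∈ Ω, HasFDerivAt Φ (Φ' x) x := fun x hx =>
    (hasFDerivAt_id x).add (B.hasFDerivAt.comp x ((hder x hx).sub A.hasFDerivAt))
  have hΦsm : ∀ x ∈ Ω, ContDiffAt ℝ ∞ Φ x := fun x hx =>
    contDiffAt_id.add (B.contDiff.contDiffAt.comp x ((hfat x hx).sub A.contDiff.contDiffAt))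
  have hΦ'0 : Φ' x₀ = ((ContinuousLinearEquiv.refl ℝ V : V ≃L[ℝ] V) : V →L[ℝ] V) := by
    ext x; simp [hΦ', ← hA]
  have hΦder0 : HasFDerivAt Φ ((ContinuousLinearEquiv.refl ℝ V : V ≃L[ℝ] V) : V →L[ℝ] V) x₀ :=
    hΦ'0 ▸ hΦder x₀ hx₀
  set e := (hΦsm x₀ hx₀).toOpenPartialHomeomorph Φ hΦder0 (by simp) with he
  have hecoe : (e : V → V) = Φ := ContDiffAt.toOpenPartialHomeomorph_coe _ hΦder0 (by simp)
  have hex₀ : x₀ ∈ e.source := (hΦsm x₀ hx₀).mem_toOpenPartialHomeomorph_source hΦder0 (by simp)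
  have hcont : ContinuousOn Φ' Ω :=
    continuousOn_const.add (continuousOn_const.clm_comp
      ((hf.continuousOn_fderiv_of_isOpen hΩ (by simp)).sub continuousOn_const))
  -- Invertibility of `Φ'` along the whole curve is used twice: for smoothness of the local inverse
  -- there, and for comparing ranks.
  have hinv : ∀ᶠ x in 𝓝 x₀, Φ' x ∈ range ((↑) : (V ≃L[ℝ] V) → V →L[ℝ] V) := by
    refine (hcont.continuousAt (hΩ.mem_nhds hx₀)).eventually ?_
    rw [hΦ'0]
    exact ContinuousLinearEquiv.nhds _
  obtain ⟨U, hUinv, hUo, hxU⟩ := eventually_nhds_iff.1 hinv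
  have hsymm0 : e.symm (Φ x₀) = x₀ := by rw [← hecoe]; exact e.left_inv hex₀
  have hT : IsOpen (e.target ∩ e.symm ⁻¹' (Ω ∩ U)) := e.isOpen_inter_preimage_symm (hΩ.inter hUo)
  have hmem0 : Φ x₀ ∈ e.target ∩ e.symm ⁻¹' (Ω ∩ U) :=
    ⟨hecoe ▸ e.map_source hex₀, by rw [mem_preimage, hsymm0]; exact ⟨hx₀, hxU⟩⟩
  have hline : Continuous fun t : ℝ => Φ x₀ + t • v := by fun_prop
  have hnear : (fun t : ℝ => Φ x₀ + t • v) ⁻¹' (e.target ∩ e.symm ⁻¹' (Ω ∩ U)) ∈ 𝓝 (0 : ℝ) :=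
    (hT.preimage hline).mem_nhds (by simpa using hmem0)
  obtain ⟨δ, hδ, hball⟩ := Metric.mem_nhds_iff.1 hnear
  rw [Real.ball_eq_Ioo, zero_sub, zero_add] at hball
  have hin : ∀ t ∈ Ioo (-δ) δ, Φ x₀ + t • v ∈ e.target ∧ e.symm (Φ x₀ + t • v) ∈ Ω ∧
      e.symm (Φ x₀ + t • v) ∈ U := fun t ht => hball ht
  have h0 : (0 : ℝ) ∈ Ioo (-δ) δ := ⟨by linarith, hδ⟩
  have hcsm : ∀ t ∈ Ioo (-δ) δ, ContDiffAt ℝ ∞ (fun t : ℝ => e.symm (Φ x₀ + t • v)) t := by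
    intro t ht
    obtain ⟨h1, h2, E, hE⟩ := (hin t ht).imp_right (And.imp_right (hUinv _))
    have hs : ContDiffAt ℝ ∞ e.symm (Φ x₀ + t • v) := by
      refine e.contDiffAt_symm (f₀' := E) h1 ?_ ?_
      · rw [hE, hecoe]; exact hΦder _ h2
      · rw [hecoe]; exact hΦsm _ h2
    have hl : ContDiffAt ℝ ∞ (fun t : ℝ => Φ x₀ + t • v) t := by fun_prop
    exact hs.comp t hl
  have hright : ∀ t ∈ Ioo (-δ) δ, Φ (e.symm (Φ x₀ + t • v)) = Φ x₀ + t • v := fun t ht => by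
    have := e.right_inv (hin t ht).1
    rwa [hecoe] at this
  have hAΦ : ∀ x, A (Φ x) = A (B (f x)) := fun x => by
    simp only [hΦ, map_add, map_sub, hB]; abel
  refine ⟨δ, fun t => e.symm (Φ x₀ + t • v), hδ, by simpa using hsymm0,
    fun t ht => (hcsm t ht).contDiffWithinAt, ?_, fun t ht => ⟨(hin t ht).2.1, ?_⟩⟩
  · have hs : HasFDerivAt e.symm
        (((ContinuousLinearEquiv.refl ℝ V).symm : V ≃L[ℝ] V) : V →L[ℝ] V) (Φ x₀) := by
      refine e.hasFDerivAt_symm hmem0.1 ?_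
      rw [hsymm0, hecoe]; exact hΦder0
    have hl : HasDerivAt (fun t : ℝ => Φ x₀ + t • v) v 0 := by
      simpa using ((hasDerivAt_id (0 : ℝ)).smul_const v).const_add (Φ x₀)
    have := HasFDerivAt.comp_hasDerivAt_of_eq (0 : ℝ) hs hl (by simp)
    simpa [Function.comp_def] using this
  · set c : ℝ → V := fun t => e.symm (Φ x₀ + t • v) with hc
    have hcd : ∀ t ∈ Ioo (-δ) δ, HasDerivAt c (deriv c t) t := fun t ht =>
      ((hcsm t ht).differentiableAt (by simp)).hasDerivAt
    have hfcd : ∀ t ∈ Ioo (-δ) δ, HasDerivAt (f ∘ c) (fderiv ℝ f (c t) (deriv c t)) t :=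
      fun t ht => (hder _ (hin t ht).2.1).comp_hasDerivAt t (hcd t ht)
    have hzero : ∀ t ∈ Ioo (-δ) δ, fderiv ℝ f (c t) (deriv c t) = 0 := by
      intro t ht
      obtain ⟨h1, h2, E, hE⟩ := (hin t ht).imp_right (And.imp_right (hUinv _))
      -- As `Φ' (c t)` is invertible, `A B ∘ Df` has the rank of `A`, which is that of `Df`. So `A
      -- B` is injective on the range of `Df`, and it suffices that `A B f` is constant along `c`;
      -- this holds because `A v = 0`.
      have hcomp : (A.comp B).comp (fderiv ℝ f (c t)) = A.comp (Φ' (c t)) := by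
        ext x; simp only [hΦ', ContinuousLinearMap.comp_apply, add_apply,
          sub_apply, map_add, map_sub, hB, ContinuousLinearMap.id_apply]; abel
      refine LinearMap.apply_eq_zero_of_finrank_range_comp (fderiv ℝ f (c t)).toLinearMap
        (A.comp B).toLinearMap ?_ ?_
      · have h3 : (A.comp B).toLinearMap ∘ₗ (fderiv ℝ f (c t)).toLinearMap =
            A.toLinearMap ∘ₗ E.toLinearEquiv.toLinearMap := by
          ext x
          have := congrArg (fun T : V →L[ℝ] F => T x) hcomp
          have hEx : E x = Φ' (c t) x := congrArg (fun T : V →L[ℝ] V => T x) hE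
          simpa [← hEx] using this
        rw [h3, LinearMap.range_comp, LinearEquiv.range, Submodule.map_top, hr _ h2]
        exact hr _ hx₀
      · have hconst : (fun s => (A.comp B) ((f ∘ c) s)) =ᶠ[𝓝 t]
            fun _ => A (Φ x₀) := by
          filter_upwards [isOpen_Ioo.mem_nhds ht] with s hs
          have : A (Φ (c s)) = A (Φ x₀ + s • v) := congrArg A (hright s hs)
          rw [hAΦ, map_add, map_smul, hv, smul_zero, add_zero] at this
          exact this
        have hd1 := (A.comp B).hasFDerivAt.comp_hasDerivAt t (hfcd t ht)
        exact hd1.unique ((hasDerivAt_const t (A (Φ x₀))).congr_of_eventuallyEq hconst)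
    have := isOpen_Ioo.is_const_of_deriv_eq_zero isPreconnected_Ioo
      (fun t ht => (hfcd t ht).differentiableAt.differentiableWithinAt)
      (fun t ht => by rw [(hfcd t ht).deriv, hzero t ht]; rfl) ht h0
    simpa [hc, hsymm0] using this

end ConstantRank

/-! ### Velocities of curves in manifolds. -/

section Velocity

variable {E : Type*} [NormedAddCommGroup E] [NormedSpace ℝ E]
  {H : Type*} [TopologicalSpace H] {I : ModelWithCorners ℝ E H}
  {M : Type*} [TopologicalSpace M] [ChartedSpace H M]
  {E' : Type*} [NormedAddCommGroup E'] [NormedSpace ℝ E']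
  {H' : Type*} [TopologicalSpace H'] {I' : ModelWithCorners ℝ E' H'}
  {M' : Type*} [TopologicalSpace M'] [ChartedSpace H' M']

/-- The curve `c` passes through `p` at time `0` with velocity `v`. -/
def HasVelocity (I : ModelWithCorners ℝ E H) (c : ℝ → M) (p : M) (v : E) : Prop :=
  c 0 = p ∧ HasMFDerivAt 𝓘(ℝ, ℝ) I c 0 (ContinuousLinearMap.toSpanSingleton ℝ v : ℝ →L[ℝ] E)

namespace HasVelocity

variable {c : ℝ → M} {p : M} {v w : E}

theorem unique (h : HasVelocity I c p v) (h' : HasVelocity I c p w) : v = w := by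
  have := hasMFDerivAt_unique h.2 h'.2
  simpa using congrArg (fun T : ℝ →L[ℝ] E => T 1) this

theorem congr {c' : ℝ → M} (h : HasVelocity I c p v) (hc : c' =ᶠ[𝓝 0] c) : HasVelocity I c' p v :=
  ⟨hc.eq_of_nhds.trans h.1, h.2.congr_of_eventuallyEq hc⟩

theorem congr_velocity (h : HasVelocity I c p v) (hvw : v = w) : HasVelocity I c p w := hvw ▸ h

theorem mfderiv_eq (h : HasVelocity I c p v) :
    (mfderiv 𝓘(ℝ, ℝ) I c 0 (1 : ℝ) : E) = v := by
  rw [h.2.mfderiv]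
  exact one_smul ℝ v

theorem const (p : M) : HasVelocity I (fun _ => p) p (0 : E) :=
  ⟨rfl, (hasMFDerivAt_const p 0).congr_mfderiv
    (ContinuousLinearMap.ext fun t : ℝ => (smul_zero (A := E) t).symm)⟩

theorem continuousAt (h : HasVelocity I c p v) : ContinuousAt c 0 := h.2.continuousAt

theorem eventually_mem (h : HasVelocity I c p v) {s : Set M} (hs : s ∈ 𝓝 p) :
    ∀ᶠ t in 𝓝 0, c t ∈ s :=
  h.continuousAt.eventually (h.1.symm ▸ hs)

theorem of_mdifferentiableAt (h0 : c 0 = p) (h : MDifferentiableAt 𝓘(ℝ, ℝ) I c 0) :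
    HasVelocity I c p (mfderiv 𝓘(ℝ, ℝ) I c 0 (1 : ℝ)) :=
  ⟨h0, h.hasMFDerivAt.congr_mfderiv (by ext; exact (one_smul ℝ _).symm)⟩

/-- No unique differentiability of `s` is needed: the curve stays in `s` near `0`, so the composite
has an unrestricted derivative. Hence every choice of derivative within `s` agrees on velocities of
such curves. -/
theorem comp_hasMFDerivWithinAt {f : M → M'} {s : Set M} {f' : E →L[ℝ] E'}
    (h : HasVelocity I c p v) (hf : HasMFDerivWithinAt I I' f s p f')
    (hs : ∀ᶠ t in 𝓝 0, c t ∈ s) : HasVelocity I' (fun t => f (c t)) (f p) (f' v) := by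
  obtain ⟨rfl, h⟩ := h
  refine ⟨rfl, ?_⟩
  have h1 := HasMFDerivWithinAt.comp (0 : ℝ) hf
    (h.hasMFDerivWithinAt (s := c ⁻¹' s)) Subset.rfl
  exact (h1.hasMFDerivAt hs).congr_mfderiv (by ext; exact map_smul f' _ _)

theorem comp_mdifferentiableWithinAt {f : M → M'} {s : Set M}
    (h : HasVelocity I c p v) (hf : MDifferentiableWithinAt I I' f s p)
    (hs : ∀ᶠ t in 𝓝 0, c t ∈ s) :
    HasVelocity I' (fun t => f (c t)) (f p) (mfderivWithin I I' f s p v) :=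
  h.comp_hasMFDerivWithinAt hf.hasMFDerivWithinAt hs

theorem comp_mdifferentiableAt {f : M → M'}
    (h : HasVelocity I c p v) (hf : MDifferentiableAt I I' f p) :
    HasVelocity I' (fun t => f (c t)) (f p) (mfderiv I I' f p v) :=
  h.comp_hasMFDerivWithinAt hf.hasMFDerivAt.hasMFDerivWithinAt (s := univ) (by simp)

theorem prodMk {c' : ℝ → M'} {p' : M'} {v' : E'} (h : HasVelocity I c p v)
    (h' : HasVelocity I' c' p' v') :
    HasVelocity (I.prod I') (fun t => (c t, c' t)) (p, p') (v, v') :=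
  ⟨Prod.ext h.1 h'.1, (h.2.prodMk h'.2).congr_mfderiv
    (ContinuousLinearMap.ext fun _ : ℝ => rfl)⟩

theorem fst {c : ℝ → M × M'} {p : M × M'} {v : E × E'} (h : HasVelocity (I.prod I') c p v) :
    HasVelocity I (fun t => (c t).1) p.1 v.1 :=
  h.comp_hasMFDerivWithinAt (s := univ) (hasMFDerivAt_fst p).hasMFDerivWithinAt (by simp)

theorem snd {c : ℝ → M × M'} {p : M × M'} {v : E × E'} (h : HasVelocity (I.prod I') c p v) :
    HasVelocity I' (fun t => (c t).2) p.2 v.2 :=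
  h.comp_hasMFDerivWithinAt (s := univ) (hasMFDerivAt_snd p).hasMFDerivWithinAt (by simp)

end HasVelocity

theorem hasVelocity_iff_hasDerivAt {c : ℝ → E} {p v : E} :
    HasVelocity 𝓘(ℝ, E) c p v ↔ c 0 = p ∧ HasDerivAt c v 0 := by
  have h : HasMFDerivAt 𝓘(ℝ, ℝ) 𝓘(ℝ, E) c 0 (ContinuousLinearMap.toSpanSingleton ℝ v : ℝ →L[ℝ] E) ↔
      HasFDerivAt c (ContinuousLinearMap.toSpanSingleton ℝ v : ℝ →L[ℝ] E) 0 :=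
    hasMFDerivAt_iff_hasFDerivAt
  exact and_congr_right fun _ => h.trans hasDerivAt_iff_hasFDerivAt.symm

theorem hasDerivAt_line (a b : E) : HasDerivAt (fun t : ℝ => a + t • b) b 0 := by
  simpa only [id, one_smul] using ((hasDerivAt_id (0 : ℝ)).smul_const b).const_add a

/-- `curveVelocities` in terms of `HasVelocity`. -/
theorem mem_curveVelocities_iff {S : Set M} {p : M} {v : TangentSpace I p} :
    v ∈ curveVelocities I S p ↔ ∃ (δ : ℝ) (c : ℝ → M), 0 < δ ∧
      ContMDiffOn 𝓘(ℝ, ℝ) I ∞ c (Ioo (-δ) δ) ∧ (∀ t ∈ Ioo (-δ) δ, c t ∈ S) ∧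
      HasVelocity I c p v := by
  constructor
  · rintro ⟨δ, c, hδ, h0, hc, hS, hv⟩
    have hd : MDifferentiableAt 𝓘(ℝ, ℝ) I c 0 :=
      (hc.contMDiffAt (isOpen_Ioo.mem_nhds ⟨by linarith, hδ⟩)).mdifferentiableAt (by simp)
    refine ⟨δ, c, hδ, hc, hS, ?_⟩
    have := HasVelocity.of_mdifferentiableAt h0 hd
    rwa [hv] at this
  · rintro ⟨δ, c, hδ, hc, hS, hv⟩
    exact ⟨δ, c, hδ, hv.1, hc, hS, hv.mfderiv_eq⟩

/-! ### Curves in charts and lifting along submersions. -/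

section Charts

variable {φ : OpenPartialHomeomorph M H} 

theorem OpenPartialHomeomorph.mdifferentiableAt_extend (hφ : φ ∈ IsManifold.maximalAtlas I ∞ M)
    {p : M} (hp : p ∈ φ.source) : MDifferentiableAt I 𝓘(ℝ, E) (φ.extend I) p :=
  (φ.contMDiffAt_extend hφ hp).mdifferentiableAt (by simp)

theorem OpenPartialHomeomorph.contMDiffOn_extend_symm_target
    (hφ : φ ∈ IsManifold.maximalAtlas I ∞ M) :
    ContMDiffOn 𝓘(ℝ, E) I ∞ (φ.extend I).symm (φ.extend I).target := by
  have := contMDiffOn_extend_symm hφ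
  rwa [φ.extend_target']

theorem OpenPartialHomeomorph.mdifferentiableAt_extend_symm [I.Boundaryless]
    (hφ : φ ∈ IsManifold.maximalAtlas I ∞ M) {x : E} (hx : x ∈ (φ.extend I).target) :
    MDifferentiableAt 𝓘(ℝ, E) I (φ.extend I).symm x :=
  ((φ.contMDiffOn_extend_symm_target hφ).contMDiffAt
    (φ.isOpen_extend_target.mem_nhds hx)).mdifferentiableAt (by simp)

/-- A curve is recovered from its image in a chart, velocity included. -/
theorem HasVelocity.extend_symm [I.Boundaryless] (hφ : φ ∈ IsManifold.maximalAtlas I ∞ M)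
    {p : M} (hp : p ∈ φ.source) {u : ℝ → E} {v : E} (hu0 : u 0 = φ.extend I p)
    (hu : HasDerivAt u (mfderiv I 𝓘(ℝ, E) (φ.extend I) p v : E) 0) :
    HasVelocity I (fun t => (φ.extend I).symm (u t)) p v := by
  have hsrc : p ∈ (φ.extend I).source := by rwa [φ.extend_source]
  have hsymm := φ.mdifferentiableAt_extend_symm hφ ((φ.extend I).map_source hsrc)
  have hinv : (φ.extend I).symm (φ.extend I p) = p := (φ.extend I).left_inv hsrc
  have hcomp : (mfderiv 𝓘(ℝ, E) I (φ.extend I).symm (φ.extend I p)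
      (mfderiv I 𝓘(ℝ, E) (φ.extend I) p v : E) : E) = v := by
    have h1 : HasMFDerivAt I I ((φ.extend I).symm ∘ φ.extend I) p _ :=
      HasMFDerivAt.comp p hsymm.hasMFDerivAt (φ.mdifferentiableAt_extend hφ hp).hasMFDerivAt
    have h2 : HasMFDerivAt I I ((φ.extend I).symm ∘ φ.extend I) p
        (ContinuousLinearMap.id ℝ E : E →L[ℝ] E) := by
      refine (hasMFDerivAt_id p).congr_of_eventuallyEq ?_
      filter_upwards [φ.open_source.mem_nhds hp] with x hx
      exact (φ.extend I).left_inv (by rwa [φ.extend_source])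
    exact congrArg (fun T : E →L[ℝ] E => T v) (hasMFDerivAt_unique h1 h2)
  have := (hasVelocity_iff_hasDerivAt.2 ⟨hu0, hu⟩).comp_mdifferentiableAt hsymm
  rw [hcomp, hinv] at this
  exact this

theorem HasVelocity.extend_symm_line [I.Boundaryless] (hφ : φ ∈ IsManifold.maximalAtlas I ∞ M)
    {p : M} (hp : p ∈ φ.source) {v V : E}
    (hV : (mfderiv I 𝓘(ℝ, E) (φ.extend I) p v : E) = V) :
    HasVelocity I (fun t => (φ.extend I).symm (φ.extend I p + t • V)) p v :=
  HasVelocity.extend_symm hφ hp (by rw [zero_smul, add_zero]) (hV ▸ hasDerivAt_line _ _)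

/-- Two vectors with the same image are both the velocity of the same chart line. -/
theorem mfderiv_extend_injective [I.Boundaryless] (hφ : φ ∈ IsManifold.maximalAtlas I ∞ M)
    {p : M} (hp : p ∈ φ.source) :
    Function.Injective (mfderiv I 𝓘(ℝ, E) (φ.extend I) p : E → E) := fun _ _ hvw =>
  (HasVelocity.extend_symm_line hφ hp hvw).unique (HasVelocity.extend_symm_line hφ hp rfl)

theorem exists_hasVelocity [I.Boundaryless] [IsManifold I ∞ M] (p : M) (v : E) :
    ∃ c, HasVelocity I c p v :=
  ⟨_, HasVelocity.extend_symm_line (IsManifold.chart_mem_maximalAtlas p) (mem_chart_source H p) rfl⟩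

/-- Curves lift along submersions, with any velocity that projects to the given one. -/
theorem Manifold.IsSubmersionAt.exists_lift [I.Boundaryless] [I'.Boundaryless] {f : M → M'} {p : M}
    (hf : Manifold.IsSubmersionAt I I' ∞ f p) {γ : ℝ → M'} {v : E}
    (hγ : HasVelocity I' γ (f p) (mfderiv I I' f p v : E')) :
    ∃ c, HasVelocity I c p v ∧ ∀ᶠ t in 𝓝 0, f (c t) = γ t := by
  set φ := hf.domChart
  set ψ := hf.codChart
  have hφ : φ ∈ IsManifold.maximalAtlas I ∞ M := hf.domChart_mem_maximalAtlas
  have hψ : ψ ∈ IsManifold.maximalAtlas I' ∞ M' := hf.codChart_mem_maximalAtlas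
  have hp : p ∈ φ.source := hf.mem_domChart_source
  have hfp : f p ∈ ψ.source := hf.mem_codChart_source
  have hpt : φ.extend I p ∈ (φ.extend I).target :=
    (φ.extend I).map_source (by rwa [φ.extend_source])
  have hloc : ∀ x ∈ φ.source, ψ.extend I' (f x) = (hf.equiv (φ.extend I x)).1 := by
    intro x hx
    have hx' : x ∈ (φ.extend I).source := by rwa [φ.extend_source]
    have : ψ.extend I' (f ((φ.extend I).symm (φ.extend I x))) = (hf.equiv (φ.extend I x)).1 :=
      hf.writtenInCharts ((φ.extend I).map_source hx')
    rwa [(φ.extend I).left_inv hx'] at this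
  have hfd : MDifferentiableAt I I' f p := hf.contMDiffAt.mdifferentiableAt (by simp)
  set V : E := mfderiv I 𝓘(ℝ, E) (φ.extend I) p v with hV
  have hγψ := hγ.comp_mdifferentiableAt (ψ.mdifferentiableAt_extend hψ hfp)
  set y' : E' := mfderiv I' 𝓘(ℝ, E') (ψ.extend I') (f p) (mfderiv I I' f p v : E') with hy'
  obtain ⟨a, ha⟩ : ∃ a : ℝ → M, HasVelocity I a p v := 
    ⟨_, HasVelocity.extend_symm_line hφ hp rfl⟩
  -- In the charts `f` is the first projection after `hf.equiv`; differentiating this along `a`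
  -- gives the claim.
  have hfst : y' = (hf.equiv V).1 := by
    have h1 := (ha.comp_mdifferentiableAt hfd).comp_mdifferentiableAt
      (ψ.mdifferentiableAt_extend hψ hfp)
    have h2 := (ha.comp_mdifferentiableAt (φ.mdifferentiableAt_extend hφ hp))
    have h3 := (hasVelocity_iff_hasDerivAt.1 h2).2
    have h4 := ((ContinuousLinearMap.fst ℝ E' hf.complement).comp
      (hf.equiv : E →L[ℝ] E' × hf.complement)).hasFDerivAt.comp_hasDerivAt 0 h3
    have h5 := (hasVelocity_iff_hasDerivAt.1 h1).2
    refine h5.unique (h4.congr_of_eventuallyEq ?_)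
    filter_upwards [ha.eventually_mem (φ.open_source.mem_nhds hp)] with t ht
    exact hloc _ ht
  have hγd := (hasVelocity_iff_hasDerivAt.1 hγψ)
  -- The first coordinate follows `γ`, and the free complementary coordinate moves linearly at the
  -- speed that makes the total velocity `V`.
  set u : ℝ → E := fun t => φ.extend I p + hf.equiv.symm
    (ψ.extend I' (γ t) - ψ.extend I' (f p), t • (hf.equiv V).2) with hu
  have hu0 : u 0 = φ.extend I p := by simp [hu, hγ.1]
  have hud : HasDerivAt u V 0 := by
    have h1 : HasDerivAt (fun t : ℝ => (ψ.extend I' (γ t) - ψ.extend I' (f p),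
        t • (hf.equiv V).2)) (y', (hf.equiv V).2) 0 :=
      (hγd.2.sub_const _).prodMk (by simpa using (hasDerivAt_id (0 : ℝ)).smul_const (hf.equiv V).2)
    have h2 := ((hf.equiv.symm : E' × hf.complement →L[ℝ] E).hasFDerivAt.comp_hasDerivAt 0 h1)
    have h3 : hf.equiv.symm (y', (hf.equiv V).2) = V := by
      rw [hfst]; exact hf.equiv.symm_apply_apply V
    have h4 := h2.const_add (φ.extend I p)
    rw [ContinuousLinearEquiv.coe_coe, h3] at h4
    exact h4
  have hc := HasVelocity.extend_symm hφ hp hu0 hud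
  refine ⟨_, hc, ?_⟩
  have hut : ∀ᶠ t in 𝓝 0, u t ∈ (φ.extend I).target :=
    hud.continuousAt.eventually (hu0.symm ▸ φ.isOpen_extend_target.mem_nhds hpt)
  filter_upwards [hut, hγ.eventually_mem (ψ.open_source.mem_nhds hfp)] with t ht hγt
  have hcs : (φ.extend I).symm (u t) ∈ φ.source := by
    rw [← φ.extend_source (I := I)]; exact (φ.extend I).map_target ht
  have h1 := hloc _ hcs
  rw [(φ.extend I).right_inv ht] at h1
  have h2 : (hf.equiv (u t)).1 = ψ.extend I' (γ t) := by
    simp only [hu, map_add, ContinuousLinearEquiv.apply_symm_apply, Prod.fst_add, hloc p hp]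
    abel
  refine (ψ.extend I').injOn ?_ ?_ (h1.trans h2)
  · rw [ψ.extend_source]; exact hf.source_subset_preimage_source hcs
  · rwa [ψ.extend_source]

end Charts
end Velocity

/-! ### Curves in a Lie groupoid and the tangent maps of its operations. -/

namespace LieGroupoid

variable {EG EQ : Type*} [NormedAddCommGroup EG] [NormedSpace ℝ EG]
  [NormedAddCommGroup EQ] [NormedSpace ℝ EQ]
  {G Q : Type*} [TopologicalSpace G] [ChartedSpace EG G]
  [TopologicalSpace Q] [ChartedSpace EQ Q] (Γ : LieGroupoid EG EQ G Q)

theorem mdifferentiableAt_src (g : G) : MDifferentiableAt 𝓘(ℝ, EG) 𝓘(ℝ, EQ) Γ.src g :=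
  (Γ.isSubmersion_src.isSubmersionAt g).contMDiffAt.mdifferentiableAt (by simp)

theorem mdifferentiableAt_tgt (g : G) : MDifferentiableAt 𝓘(ℝ, EG) 𝓘(ℝ, EQ) Γ.tgt g :=
  (Γ.isSubmersion_tgt.isSubmersionAt g).contMDiffAt.mdifferentiableAt (by simp)

theorem mdifferentiableWithinAt_mul {p : G × G} (hp : Γ.tgt p.1 = Γ.src p.2) :
    MDifferentiableWithinAt (𝓘(ℝ, EG).prod 𝓘(ℝ, EG)) 𝓘(ℝ, EG) (fun p : G × G => Γ.mul p.1 p.2)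
      Γ.composable p :=
  (Γ.contMDiffOn_mul p hp).mdifferentiableWithinAt (by simp)

theorem inv_mul_cancel_left {g h : G} (hgh : Γ.tgt g = Γ.src h) :
    Γ.mul (Γ.inv g) (Γ.mul g h) = h := by
  rw [← Γ.mul_assoc _ _ _ (Γ.tgt_inv g) hgh, Γ.inv_mul, hgh, Γ.one_mul]

theorem mul_inv_cancel_left {g h : G} (hgh : Γ.src g = Γ.src h) :
    Γ.mul g (Γ.mul (Γ.inv g) h) = h := by
  rw [← Γ.mul_assoc _ _ _ (Γ.src_inv g).symm ((Γ.tgt_inv g).trans hgh), Γ.mul_inv, hgh, Γ.one_mul]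

theorem hasVelocity_tangentMul {c : ℝ → G × G} {p : G × G} {v : EG × EG}
    (hp : p ∈ Γ.composable) (hc : HasVelocity (𝓘(ℝ, EG).prod 𝓘(ℝ, EG)) c p v)
    (h : ∀ᶠ t in 𝓝 0, c t ∈ Γ.composable) :
    HasVelocity 𝓘(ℝ, EG) (fun t => Γ.mul (c t).1 (c t).2) (Γ.mul p.1 p.2) (Γ.tangentMul p v) :=
  hc.comp_mdifferentiableWithinAt (Γ.mdifferentiableWithinAt_mul hp) h

theorem hasVelocity_mul {a b : ℝ → G} {g h : G} {v w : EG} (hgh : Γ.tgt g = Γ.src h)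
    (ha : HasVelocity 𝓘(ℝ, EG) a g v) (hb : HasVelocity 𝓘(ℝ, EG) b h w)
    (hab : ∀ᶠ t in 𝓝 0, Γ.tgt (a t) = Γ.src (b t)) :
    HasVelocity 𝓘(ℝ, EG) (fun t => Γ.mul (a t) (b t)) (Γ.mul g h)
      (Γ.tangentMul (g, h) ((v, w) : EG × EG)) :=
  Γ.hasVelocity_tangentMul (p := (g, h)) hgh (ha.prodMk hb) hab

theorem mdifferentiableWithinAt_mul_left {g : G} {q : Q} (hg : Γ.tgt g = q) :
    MDifferentiableWithinAt 𝓘(ℝ, EG) 𝓘(ℝ, EG) (fun h => Γ.mul g h) (Γ.src ⁻¹' {q}) (Γ.one q) := by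
  have h1 : ContMDiffOn 𝓘(ℝ, EG) 𝓘(ℝ, EG) ∞ (fun h => Γ.mul g h) (Γ.src ⁻¹' {q}) :=
    Γ.contMDiffOn_mul.comp (f := fun h : G => (g, h))
      (contMDiff_const.prodMk contMDiff_id).contMDiffOn (fun h hh => hg.trans hh.symm)
  exact (h1 _ (Γ.src_one q)).mdifferentiableWithinAt (by simp)

theorem mdifferentiableWithinAt_inv_mul {g : G} {q : Q} (hg : Γ.src g = q) :
    MDifferentiableWithinAt 𝓘(ℝ, EG) 𝓘(ℝ, EG) (fun h => Γ.mul (Γ.inv h) g) (Γ.src ⁻¹' {q})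
      (Γ.one q) := by
  have h1 : ContMDiffOn 𝓘(ℝ, EG) 𝓘(ℝ, EG) ∞ (fun h => Γ.mul (Γ.inv h) g) (Γ.src ⁻¹' {q}) :=
    Γ.contMDiffOn_mul.comp (f := fun h : G => (Γ.inv h, g))
      (Γ.contMDiff_inv.prodMk contMDiff_const).contMDiffOn
      (fun h hh => (Γ.tgt_inv h).trans (hh.trans hg.symm))
  exact (h1 _ (Γ.src_one q)).mdifferentiableWithinAt (by simp)

theorem inv_one (q : Q) : Γ.inv (Γ.one q) = Γ.one q := by
  have h := Γ.inv_mul (Γ.one q)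
  have h2 := Γ.mul_one (Γ.inv (Γ.one q))
  rw [Γ.tgt_inv, Γ.src_one] at h2
  rw [Γ.tgt_one] at h
  exact h2.symm.trans h

theorem hasVelocity_leftTranslate {g : G} {q : Q} (hg : Γ.tgt g = q) {c : ℝ → G} {v : EG}
    (hc : HasVelocity 𝓘(ℝ, EG) c (Γ.one q) v) (h : ∀ᶠ t in 𝓝 0, Γ.src (c t) = q) :
    HasVelocity 𝓘(ℝ, EG) (fun t => Γ.mul g (c t)) g (Γ.leftTranslate q g v : EG) := by
  have := hc.comp_mdifferentiableWithinAt (Γ.mdifferentiableWithinAt_mul_left hg) h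
  have h1 : Γ.mul g (Γ.one q) = g := hg ▸ Γ.mul_one g
  exact ⟨this.1.trans h1, this.2⟩

/-- The sign cancels the one built into `rightTranslate`; this is why the isomorphism of (a) carries
a minus in its second component. -/
theorem hasVelocity_rightTranslate {g : G} {q : Q} (hg : Γ.src g = q) {c : ℝ → G} {v : EG}
    (hc : HasVelocity 𝓘(ℝ, EG) c (Γ.one q) v) (h : ∀ᶠ t in 𝓝 0, Γ.src (c t) = q) :
    HasVelocity 𝓘(ℝ, EG) (fun t => Γ.mul (Γ.inv (c t)) g) g (-(Γ.rightTranslate q g v : EG)) := by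
  have := hc.comp_mdifferentiableWithinAt (Γ.mdifferentiableWithinAt_inv_mul hg) h
  have h1 : Γ.mul (Γ.inv (Γ.one q)) g = g := by rw [Γ.inv_one]; exact hg ▸ Γ.one_mul g
  have h2 : -(Γ.rightTranslate q g v : EG) = (mfderivWithin 𝓘(ℝ, EG) 𝓘(ℝ, EG)
      (fun h => Γ.mul (Γ.inv h) g) (Γ.src ⁻¹' {q}) (Γ.one q) : EG →L[ℝ] EG) v :=
    neg_neg (G := EG) _
  rw [h2]
  exact ⟨this.1.trans h1, this.2⟩

/-- Lift the constant curve along the submersion `Γ.src`. -/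
theorem exists_curve_in_src_fiber {g : G} {q : Q} (hg : Γ.src g = q) {v : EG}
    (hv : (mfderiv 𝓘(ℝ, EG) 𝓘(ℝ, EQ) Γ.src g v : EQ) = 0) :
    ∃ c, HasVelocity 𝓘(ℝ, EG) c g v ∧ ∀ᶠ t in 𝓝 0, Γ.src (c t) = q := by
  have h := (HasVelocity.const (I := 𝓘(ℝ, EQ)) (Γ.src g)).congr_velocity hv.symm
  subst hg
  exact (Γ.isSubmersion_src.isSubmersionAt g).exists_lift h

/-- Take any curve `a` with velocity `v` and lift `Γ.tgt ∘ a` along `Γ.src` through `h`, with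
velocity `w`. -/
theorem exists_composable_curves [IsManifold 𝓘(ℝ, EG) ∞ G] {g h : G} (hgh : Γ.tgt g = Γ.src h) {v w : EG}
    (hvw : (mfderiv 𝓘(ℝ, EG) 𝓘(ℝ, EQ) Γ.tgt g v : EQ) = mfderiv 𝓘(ℝ, EG) 𝓘(ℝ, EQ) Γ.src h w) :
    ∃ a b, HasVelocity 𝓘(ℝ, EG) a g v ∧ HasVelocity 𝓘(ℝ, EG) b h w ∧
      ∀ᶠ t in 𝓝 0, Γ.tgt (a t) = Γ.src (b t) := by
  obtain ⟨a, ha⟩ := exists_hasVelocity (I := 𝓘(ℝ, EG)) g v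
  have h1 := ha.comp_mdifferentiableAt (Γ.mdifferentiableAt_tgt g)
  rw [hvw, hgh] at h1
  obtain ⟨b, hb, hab⟩ := (Γ.isSubmersion_src.isSubmersionAt h).exists_lift h1
  exact ⟨a, b, ha, hb, hab.mono fun _ => Eq.symm⟩

/-- Left translations are injective on tangent vectors of the source fibres. -/
theorem eq_zero_of_hasVelocity_mul_left {g h : G} (hgh : Γ.tgt g = Γ.src h) {d : ℝ → G} {w : EG}
    (hd : HasVelocity 𝓘(ℝ, EG) d h w) (hs : ∀ᶠ t in 𝓝 0, Γ.src (d t) = Γ.tgt g)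
    (h0 : HasVelocity 𝓘(ℝ, EG) (fun t => Γ.mul g (d t)) (Γ.mul g h) (0 : EG)) : w = 0 := by
  -- Multiplying `g d(t)` by the constant `g⁻¹` recovers `d`, and both factors have velocity `0`.
  have h1 := Γ.hasVelocity_mul (g := Γ.inv g) (h := Γ.mul g h)
    (by rw [Γ.tgt_inv, Γ.src_mul _ _ hgh]) (HasVelocity.const (Γ.inv g)) h0 (by
      filter_upwards [hs] with t ht
      rw [Γ.tgt_inv, Γ.src_mul _ _ ht.symm])
  have h2 : (Γ.tangentMul (Γ.inv g, Γ.mul g h) ((0, 0) : EG × EG) : EG) = 0 :=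
    map_zero (Γ.tangentMul (Γ.inv g, Γ.mul g h))
  rw [h2, Γ.inv_mul_cancel_left hgh] at h1
  refine hd.unique (h1.congr ?_)
  filter_upwards [hs] with t ht
  exact (Γ.inv_mul_cancel_left ht.symm).symm

/-! ### Part (a): translates and the kernel of the tangent multiplication. -/

section Trajectories

variable {g₁ g₂ : G} {q : Q}

/-- The pair of translates of `v ∈ A_q G` is tangent to `G₂` and killed by the tangent map of the
multiplication. -/
theorem translates_tangent (h₁ : Γ.tgt g₁ = q) (h₂ : Γ.src g₂ = q) {v : EG}
    (hv : v ∈ Γ.algebroidFiber q) :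
    (mfderiv 𝓘(ℝ, EG) 𝓘(ℝ, EQ) Γ.tgt g₁ (Γ.leftTranslate q g₁ v : EG) : EQ) =
        mfderiv 𝓘(ℝ, EG) 𝓘(ℝ, EQ) Γ.src g₂ (-(Γ.rightTranslate q g₂ v : EG) : EG) ∧
      (Γ.tangentMul (g₁, g₂)
        ((Γ.leftTranslate q g₁ v, -(Γ.rightTranslate q g₂ v : EG)) : EG × EG) : EG) = 0 := by
  obtain ⟨c, hc, hs⟩ := Γ.exists_curve_in_src_fiber (Γ.src_one q) hv
  have ha := Γ.hasVelocity_leftTranslate h₁ hc hs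
  have hb := Γ.hasVelocity_rightTranslate h₂ hc hs
  have hab : ∀ᶠ t in 𝓝 0, Γ.tgt (Γ.mul g₁ (c t)) = Γ.src (Γ.mul (Γ.inv (c t)) g₂) := by
    filter_upwards [hs] with t ht
    rw [Γ.tgt_mul _ _ (h₁.trans ht.symm), Γ.src_mul _ _ (by rw [Γ.tgt_inv, ht, h₂]), Γ.src_inv]
  constructor
  · have h := (hb.comp_mdifferentiableAt (Γ.mdifferentiableAt_src g₂)).congr hab
    have h' := ha.comp_mdifferentiableAt (Γ.mdifferentiableAt_tgt g₁)
    rw [h₁.trans h₂.symm] at h'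
    exact h'.unique h
  -- The product `(g₁ c)(c⁻¹ g₂)` is constantly `g₁ g₂`.
  · refine (Γ.hasVelocity_mul (h₁.trans h₂.symm) ha hb hab).unique
      ((HasVelocity.const (Γ.mul g₁ g₂)).congr ?_)
    filter_upwards [hs] with t ht
    have h3 : Γ.tgt (Γ.inv (c t)) = Γ.src g₂ := by rw [Γ.tgt_inv, ht, h₂]
    rw [Γ.mul_assoc _ _ _ (h₁.trans ht.symm) (by rw [Γ.src_mul _ _ h3, Γ.src_inv]),
      Γ.mul_inv_cancel_left (ht.trans h₂.symm)]

theorem leftTranslate_injOn (h₁ : Γ.tgt g₁ = q) {v : EG} (hv : v ∈ Γ.algebroidFiber q)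
    (h0 : (Γ.leftTranslate q g₁ v : EG) = 0) : v = 0 := by
  obtain ⟨c, hc, hs⟩ := Γ.exists_curve_in_src_fiber (Γ.src_one q) hv
  have ha := Γ.hasVelocity_leftTranslate h₁ hc hs
  rw [h0] at ha
  refine Γ.eq_zero_of_hasVelocity_mul_left (h₁.trans (Γ.src_one q).symm) hc
    (hs.mono fun _ ht => ht.trans h₁.symm) ?_
  rwa [← h₁, Γ.mul_one]

/-- Vectors tangent to the source fibre are left translates. -/
theorem exists_leftTranslate_eq (h₁ : Γ.tgt g₁ = q) {w : EG}
    (hw : (mfderiv 𝓘(ℝ, EG) 𝓘(ℝ, EQ) Γ.src g₁ w : EQ) = 0) :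
    ∃ v : EG, v ∈ Γ.algebroidFiber q ∧ (Γ.leftTranslate q g₁ v : EG) = w := by
  obtain ⟨a, ha, hs⟩ := Γ.exists_curve_in_src_fiber rfl hw
  -- The curve `g₁⁻¹ a(t)` passes through `ε(q)` inside the source fibre of `q`; its velocity is the
  -- required `v`.
  have hc := Γ.hasVelocity_mul (Γ.tgt_inv g₁) (HasVelocity.const (Γ.inv g₁)) ha
    (hs.mono fun t ht => (Γ.tgt_inv g₁).trans ht.symm)
  rw [Γ.inv_mul, h₁] at hc
  have hsc : ∀ᶠ t in 𝓝 0, Γ.src (Γ.mul (Γ.inv g₁) (a t)) = q := by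
    filter_upwards [hs] with t ht
    rw [Γ.src_mul _ _ ((Γ.tgt_inv g₁).trans ht.symm), Γ.src_inv, h₁]
  refine ⟨Γ.tangentMul (Γ.inv g₁, g₁) ((0, w) : EG × EG), ?_, ?_⟩
  rotate_left
  · refine (Γ.hasVelocity_leftTranslate h₁ hc hsc).unique (ha.congr ?_)
    filter_upwards [hs] with t ht
    exact Γ.mul_inv_cancel_left ht.symm
  · have h := hc.comp_mdifferentiableAt (Γ.mdifferentiableAt_src (Γ.one q))
    refine h.unique ((HasVelocity.const (Γ.src (Γ.one q))).congr ?_)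
    filter_upwards [hsc] with t ht
    rw [ht, Γ.src_one]

/-- A vector tangent to `G₂` and killed by the tangent map of the multiplication is the pair of
translates of an element of the Lie algebroid. -/
theorem exists_translates_eq [IsManifold 𝓘(ℝ, EG) ∞ G] (h₁ : Γ.tgt g₁ = q) (h₂ : Γ.src g₂ = q) {v₁ v₂ : EG}
    (hv : (mfderiv 𝓘(ℝ, EG) 𝓘(ℝ, EQ) Γ.tgt g₁ v₁ : EQ) = mfderiv 𝓘(ℝ, EG) 𝓘(ℝ, EQ) Γ.src g₂ v₂)
    (hm : (Γ.tangentMul (g₁, g₂) ((v₁, v₂) : EG × EG) : EG) = 0) :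
    ∃ v : EG, v ∈ Γ.algebroidFiber q ∧ (Γ.leftTranslate q g₁ v : EG) = v₁ ∧
      -(Γ.rightTranslate q g₂ v : EG) = v₂ := by
  have h₁₂ := h₁.trans h₂.symm
  obtain ⟨a, b, ha, hb, hab⟩ := Γ.exists_composable_curves h₁₂ hv
  have hmul := Γ.hasVelocity_mul h₁₂ ha hb hab
  rw [hm] at hmul
  have hsrc : (mfderiv 𝓘(ℝ, EG) 𝓘(ℝ, EQ) Γ.src g₁ v₁ : EQ) = 0 := by
    have h := (hmul.comp_mdifferentiableAt (Γ.mdifferentiableAt_src _)).congr_velocity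
      (map_zero (mfderiv 𝓘(ℝ, EG) 𝓘(ℝ, EQ) Γ.src (Γ.mul g₁ g₂)))
    rw [Γ.src_mul _ _ h₁₂] at h
    refine (ha.comp_mdifferentiableAt (Γ.mdifferentiableAt_src g₁)).unique (h.congr ?_)
    filter_upwards [hab] with t ht
    exact (Γ.src_mul _ _ ht).symm
  obtain ⟨v, hvA, hvL⟩ := Γ.exists_leftTranslate_eq h₁ hsrc
  refine ⟨v, hvA, hvL, ?_⟩
  obtain ⟨ht1, ht2⟩ := Γ.translates_tangent h₁ h₂ hvA
  rw [hvL] at ht1 ht2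
  set w : EG := -(Γ.rightTranslate q g₂ v : EG)
  -- Both `(v₁, w)` and `(v₁, v₂)` are composable and killed by the tangent multiplication. Their
  -- difference `(0, w - v₂)` is a vector in the source fibre killed by left translation by `g₁`,
  -- hence zero.
  have hd : (mfderiv 𝓘(ℝ, EG) 𝓘(ℝ, EQ) Γ.src g₂ (w - v₂) : EQ) = 0 :=
    (map_sub (mfderiv 𝓘(ℝ, EG) 𝓘(ℝ, EQ) Γ.src g₂ : EG →L[ℝ] EQ) w v₂).trans
      (sub_eq_zero.2 (ht1.symm.trans hv))
  obtain ⟨d, hd, hds⟩ := Γ.exists_curve_in_src_fiber h₂ hd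
  have hdm := Γ.hasVelocity_mul h₁₂ (HasVelocity.const g₁) hd (hds.mono fun t ht => h₁.trans ht.symm)
  have hz : (Γ.tangentMul (g₁, g₂) ((0, w - v₂) : EG × EG) : EG) = 0 := by
    have h := map_sub (Γ.tangentMul (g₁, g₂) : EG × EG →L[ℝ] EG) (v₁, w) (v₁, v₂)
    rw [Prod.mk_sub_mk, sub_self] at h
    exact h.trans (sub_eq_zero.2 (ht2.trans hm.symm))
  rw [hz] at hdm
  exact sub_eq_zero.1 (Γ.eq_zero_of_hasVelocity_mul_left h₁₂ hd
    (hds.mono fun t ht => ht.trans h₁.symm) hdm)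

theorem exists_equiv_variations [IsManifold 𝓘(ℝ, EG) ∞ G] (N : Set G) (h₁ : Γ.tgt g₁ = q) (h₂ : Γ.src g₂ = q) :
    ∃ e : Γ.algebroidSubspace N q g₁ g₂ ≃ₗ[ℝ] Γ.variations N g₁ g₂,
      ∀ v : Γ.algebroidSubspace N q g₁ g₂,
        (e v : TangentSpace (𝓘(ℝ, EG).prod 𝓘(ℝ, EG)) ((g₁, g₂) : G × G)) =
          (Γ.leftTranslate q g₁ v, -Γ.rightTranslate q g₂ v) := by
  let T : EG →ₗ[ℝ] EG × EG := LinearMap.prod (Γ.leftTranslate q g₁ : EG →L[ℝ] EG).toLinearMap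
    (-(Γ.rightTranslate q g₂ : EG →L[ℝ] EG)).toLinearMap
  let S : Submodule ℝ EG := Γ.algebroidSubspace N q g₁ g₂
  let W : Submodule ℝ (EG × EG) := Γ.variations N g₁ g₂
  have hmaps : ∀ v : S, (T ∘ₗ S.subtype) v ∈ W := by
    rintro ⟨v, ⟨hvA, hvL⟩, hvR⟩
    obtain ⟨h3, h4⟩ := Γ.translates_tangent h₁ h₂ hvA
    exact ⟨⟨hvL, neg_mem hvR, h3⟩, h4⟩
  let F : S →ₗ[ℝ] W := (T ∘ₗ S.subtype).codRestrict W hmaps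
  have hinj : Function.Injective F := by
    rw [injective_iff_map_eq_zero]
    rintro ⟨v, ⟨hvA, hvL⟩, hvR⟩ h
    have h' : T v = 0 := congrArg Subtype.val h
    exact Subtype.ext (Γ.leftTranslate_injOn h₁ hvA (congrArg Prod.fst h'))
  have hsurj : Function.Surjective F := by
    rintro ⟨⟨v₁, v₂⟩, ⟨hN₁, hN₂, hv⟩, hm⟩
    obtain ⟨v, hvA, rfl, rfl⟩ := Γ.exists_translates_eq h₁ h₂ hv hm
    have hR := neg_mem_iff (S := Submodule ℝ EG) (H := tangentSpaceOf 𝓘(ℝ, EG) N g₂)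
      (x := Γ.rightTranslate q g₂ v)
    exact ⟨⟨v, ⟨hvA, hN₁⟩, hR.1 hN₂⟩, rfl⟩
  exact ⟨LinearEquiv.ofBijective F ⟨hinj, hsurj⟩, fun v => rfl⟩

end Trajectories

end LieGroupoid

/-! ### Local parametrization of embedded submanifolds. -/

section Submanifold

variable {E : Type*} [NormedAddCommGroup E] [NormedSpace ℝ E] [FiniteDimensional ℝ E]
  {H : Type*} [TopologicalSpace H] {I : ModelWithCorners ℝ E H} [I.Boundaryless]
  {M : Type*} [TopologicalSpace M] [ChartedSpace H M]

/-- Near each of its points an embedded submanifold `S` has a smooth parametrization `ψ` by an open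
subset of a vector space, and the range of the derivative of `ψ` is the tangent space of `S`. -/
theorem IsEmbeddedSubmanifold.exists_parametrization {S : Set M} (hS : IsEmbeddedSubmanifold I S)
    {p : M} (hp : p ∈ S) :
    ∃ (W : Submodule ℝ E) (Ω : Set W) (ψ : W → M), IsOpen Ω ∧ 0 ∈ Ω ∧ ψ 0 = p ∧
      ContMDiffOn 𝓘(ℝ, W) I ∞ ψ Ω ∧ (∀ w ∈ Ω, ψ w ∈ S) ∧
      ∀ w ∈ Ω, (tangentSpaceOf I S (ψ w) : Submodule ℝ E) =
        LinearMap.range (mfderiv 𝓘(ℝ, W) I ψ w : W →L[ℝ] E).toLinearMap := by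
  obtain ⟨φ, hφ, hpφ, W, hW⟩ := hS p hp
  set x₀ := φ.extend I p
  have hx₀ : x₀ ∈ (φ.extend I).target := (φ.extend I).map_source (by rwa [φ.extend_source])
  have hinv : (φ.extend I).symm x₀ = p := (φ.extend I).left_inv (by rwa [φ.extend_source])
  set Ω : Set W := (fun w : W => x₀ + (w : E)) ⁻¹' (φ.extend I).target with hΩdef
  set ψ : W → M := fun w => (φ.extend I).symm (x₀ + (w : E)) with hψdef
  have hΩ : IsOpen Ω := φ.isOpen_extend_target.preimage (by fun_prop)
  have htrans : ContDiff ℝ ∞ fun w : W => x₀ + (w : E) := contDiff_const.add W.subtypeL.contDiff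
  have hψ : ContMDiffOn 𝓘(ℝ, W) I ∞ ψ Ω :=
    (φ.contMDiffOn_extend_symm_target hφ).comp htrans.contMDiff.contMDiffOn fun _ h => h
  have hsrc : ∀ w ∈ Ω, ψ w ∈ φ.source := fun w hw => by
    rw [← φ.extend_source (I := I)]; exact (φ.extend I).map_target hw
  have hright : ∀ w ∈ Ω, φ.extend I (ψ w) = x₀ + (w : E) := fun w hw => (φ.extend I).right_inv hw
  have hψS : ∀ w ∈ Ω, ψ w ∈ S := fun w hw =>
    (hW _ (hsrc w hw)).2 (by rw [hright w hw, add_sub_cancel_left]; exact w.2)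
  have hψd : ∀ w ∈ Ω, MDifferentiableAt 𝓘(ℝ, W) I ψ w := fun w hw =>
    (hψ.contMDiffAt (hΩ.mem_nhds hw)).mdifferentiableAt (by simp)
  refine ⟨W, Ω, ψ, hΩ, by simpa [hΩdef] using hx₀, by simpa [hψdef] using hinv, hψ, hψS, ?_⟩
  intro w hw
  apply le_antisymm
  · refine Submodule.span_le.2 fun v hv => ?_
    obtain ⟨δ, c, hδ, -, hcS, hc⟩ := mem_curveVelocities_iff.1 hv
    -- A linear retraction `P` of `E` onto `W` turns the chart image of `c` into a curve in `W`,
    -- differentiable at `0`, whose composite with `ψ` is `c` near `0`.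
    obtain ⟨P, hP⟩ := LinearMap.exists_leftInverse_of_injective W.subtype W.ker_subtype
    have hPw : ∀ y : W, P.toContinuousLinearMap (y : E) = y := fun y => LinearMap.congr_fun hP y
    have hu := hasVelocity_iff_hasDerivAt.1
      (hc.comp_mdifferentiableAt (φ.mdifferentiableAt_extend hφ (hsrc w hw)))
    have hb := P.toContinuousLinearMap.hasFDerivAt.comp_hasDerivAt 0 (hu.2.sub_const x₀)
    have hb' := (hasVelocity_iff_hasDerivAt.2 ⟨by
      simp only [Function.comp_apply, hu.1, hright w hw, add_sub_cancel_left, hPw], hb⟩ :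
        HasVelocity 𝓘(ℝ, W) _ w _).comp_mdifferentiableAt (hψd w hw)
    refine ⟨_, hb'.unique (hc.congr ?_)⟩
    filter_upwards [Ioo_mem_nhds (neg_lt_zero.2 hδ) hδ,
      hc.eventually_mem (φ.open_source.mem_nhds (hsrc w hw))] with t ht htφ
    have h1 : φ.extend I (c t) - x₀ ∈ W := (hW _ htφ).1 (hcS t ht)
    have h2 := congrArg Subtype.val (hPw ⟨_, h1⟩)
    change (φ.extend I).symm (x₀ + ((P.toContinuousLinearMap (φ.extend I (c t) - x₀) : W) : E)) = c t
    rw [h2, add_sub_cancel]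
    exact (φ.extend I).left_inv (by rwa [φ.extend_source])
  · rintro _ ⟨(u : W), rfl⟩
    refine Submodule.subset_span (mem_curveVelocities_iff.2 ?_)
    have hline : ContDiff ℝ ∞ fun t : ℝ => w + t • u := by fun_prop
    have hnear : (fun t : ℝ => w + t • u) ⁻¹' Ω ∈ 𝓝 (0 : ℝ) :=
      (hΩ.preimage hline.continuous).mem_nhds (by simpa using hw)
    obtain ⟨δ, hδ, hball⟩ := Metric.mem_nhds_iff.1 hnear
    rw [Real.ball_eq_Ioo, zero_sub, zero_add] at hball
    refine ⟨δ, fun t => ψ (w + t • u), hδ, hψ.comp hline.contMDiff.contMDiffOn hball,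
      fun t ht => hψS _ (hball ht), ?_⟩
    exact (hasVelocity_iff_hasDerivAt.2 ⟨by rw [zero_smul, add_zero], hasDerivAt_line w u⟩ :
      HasVelocity 𝓘(ℝ, W) _ w u).comp_mdifferentiableAt (hψd w hw)

end Submanifold

/-! ### Part (b): variations as velocities of curves of admissible pairs. -/

namespace LieGroupoid

variable {EG EQ : Type*} [NormedAddCommGroup EG] [NormedSpace ℝ EG]
  [NormedAddCommGroup EQ] [NormedSpace ℝ EQ]
  {G Q : Type*} [TopologicalSpace G] [ChartedSpace EG G]
  [TopologicalSpace Q] [ChartedSpace EQ Q] (Γ : LieGroupoid EG EQ G Q)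

theorem curveVelocities_admissible_subset (N : Set G) {g g₁ g₂ : G}
    (hg : (g₁, g₂) ∈ Γ.admissible N g) :
    curveVelocities (𝓘(ℝ, EG).prod 𝓘(ℝ, EG)) (Γ.admissible N g) (g₁, g₂) ⊆
      (Γ.variations N g₁ g₂ : Set (TangentSpace (𝓘(ℝ, EG).prod 𝓘(ℝ, EG)) ((g₁, g₂) : G × G))) := by
  intro v hv
  obtain ⟨δ, c, hδ, hcs, hcS, hc⟩ := mem_curveVelocities_iff.1 hv
  have hnear : ∀ᶠ t in 𝓝 (0 : ℝ), t ∈ Ioo (-δ) δ := Ioo_mem_nhds (neg_lt_zero.2 hδ) hδ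
  have hcomp : ∀ᶠ t in 𝓝 0, Γ.tgt (c t).1 = Γ.src (c t).2 :=
    hnear.mono fun t ht => (hcS t ht).1.1
  refine ⟨⟨?_, ?_, ?_⟩, ?_⟩
  · exact Submodule.subset_span (mem_curveVelocities_iff.2
      ⟨δ, fun t => (c t).1, hδ, contMDiff_fst.comp_contMDiffOn hcs,
        fun t ht => (hcS t ht).1.2.1, hc.fst⟩)
  · exact Submodule.subset_span (mem_curveVelocities_iff.2
      ⟨δ, fun t => (c t).2, hδ, contMDiff_snd.comp_contMDiffOn hcs,
        fun t ht => (hcS t ht).1.2.2, hc.snd⟩)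
  · have h1 := hc.fst.comp_mdifferentiableAt (Γ.mdifferentiableAt_tgt g₁)
    rw [show Γ.tgt g₁ = Γ.src g₂ from hg.1.1] at h1
    exact h1.unique ((hc.snd.comp_mdifferentiableAt (Γ.mdifferentiableAt_src g₂)).congr hcomp)
  · refine (Γ.hasVelocity_tangentMul hg.1.1 hc hcomp).unique ?_
    refine (HasVelocity.const (Γ.mul g₁ g₂)).congr (hnear.mono fun t ht => ?_)
    exact (hcS t ht).2.trans hg.2.symm

variable [FiniteDimensional ℝ EG] [IsManifold 𝓘(ℝ, EG) ∞ G]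

/-- The constant rank theorem for the product restricted to `G₂ ∩ (N × N)`. Cleanness is not
involved: tangency of `v` to the intersection is assumed directly. -/
theorem mem_curveVelocities_admissible {N : Set G} {g : G}
    (hN₂ : IsEmbeddedSubmanifold (𝓘(ℝ, EG).prod 𝓘(ℝ, EG)) (Γ.composableIn N))
    {U : Set (G × G)} (hU : IsOpen U) {r : ℕ} (hr : ∀ p ∈ Γ.composableIn N ∩ U, Γ.rankMulOn N p = r)
    {p : G × G} (hp : p ∈ Γ.admissible N g) (hpU : p ∈ U) {v : EG × EG}
    (hv : v ∈ tangentSpaceOf (𝓘(ℝ, EG).prod 𝓘(ℝ, EG)) (Γ.composableIn N) p)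
    (hm : (Γ.tangentMul p v : EG) = 0) :
    v ∈ curveVelocities (𝓘(ℝ, EG).prod 𝓘(ℝ, EG)) (Γ.admissible N g) p := by
  obtain ⟨W, Ω, ψ, hΩ, h0, rfl, hψ, hψS, hψT⟩ := hN₂.exists_parametrization hp.1
  set μ : G × G → G := fun p => Γ.mul p.1 p.2
  set χ := chartAt EG g
  have hχ : χ ∈ IsManifold.maximalAtlas 𝓘(ℝ, EG) ∞ G := IsManifold.chart_mem_maximalAtlas g
  have hμψ : ContMDiffOn 𝓘(ℝ, W) 𝓘(ℝ, EG) ∞ (fun w => μ (ψ w)) Ω :=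
    Γ.contMDiffOn_mul.comp hψ fun w hw => (hψS w hw).1
  -- The first factor secures constant rank, the second lets the product be read in the chart `χ` at
  -- `g`.
  set Ω₁ : Set W := (Ω ∩ ψ ⁻¹' U) ∩ (Ω ∩ (fun w => μ (ψ w)) ⁻¹' χ.source)
  have hΩ₁ : IsOpen Ω₁ := (hψ.continuousOn.isOpen_inter_preimage hΩ hU).inter
    (hμψ.continuousOn.isOpen_inter_preimage hΩ χ.open_source)
  have hμ0 : μ (ψ 0) = g := hp.2
  have h0₁ : (0 : W) ∈ Ω₁ := ⟨⟨h0, hpU⟩, h0, by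
    rw [mem_preimage, hμ0]; exact mem_chart_source EG g⟩
  set f : W → EG := fun w => χ.extend 𝓘(ℝ, EG) (μ (ψ w))
  have hf : ContDiffOn ℝ ∞ f Ω₁ := contMDiffOn_iff_contDiffOn.1
    ((χ.contMDiffOn_extend hχ).comp (hμψ.mono fun w hw => hw.1.1) fun w hw => hw.2.2)
  let T (w : W) : W →L[ℝ] EG := (Γ.tangentMul (ψ w) : EG × EG →L[ℝ] EG).comp
    (mfderiv 𝓘(ℝ, W) (𝓘(ℝ, EG).prod 𝓘(ℝ, EG)) ψ w : W →L[ℝ] EG × EG)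
  let D (w : W) : EG →L[ℝ] EG := mfderiv 𝓘(ℝ, EG) 𝓘(ℝ, EG) (χ.extend 𝓘(ℝ, EG)) (μ (ψ w))
  have hfd : ∀ w ∈ Ω₁, fderiv ℝ f w = (D w).comp (T w) := by
    intro w hw
    have h1 : HasMFDerivAt 𝓘(ℝ, W) (𝓘(ℝ, EG).prod 𝓘(ℝ, EG)) ψ w _ :=
      ((hψ.contMDiffAt (hΩ.mem_nhds hw.1.1)).mdifferentiableAt (by simp)).hasMFDerivAt
    have h2 := (Γ.mdifferentiableWithinAt_mul (hψS w hw.1.1).1).hasMFDerivWithinAt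
    have h3 := (HasMFDerivWithinAt.comp w h2 (h1.hasMFDerivWithinAt (s := Ω))
      fun w hw => (hψS w hw).1).hasMFDerivAt (hΩ.mem_nhds hw.1.1)
    have h4 := HasMFDerivAt.comp w
      (χ.mdifferentiableAt_extend hχ hw.2.2).hasMFDerivAt h3
    have h5 : HasFDerivAt f ((D w).comp (T w)) w := hasMFDerivAt_iff_hasFDerivAt.1 h4
    exact h5.fderiv
  have hrank : ∀ w ∈ Ω₁, Module.finrank ℝ (LinearMap.range (fderiv ℝ f w).toLinearMap) = r := by
    intro w hw
    rw [← hr (ψ w) ⟨hψS w hw.1.1, hw.1.2⟩, hfd w hw]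
    have h1 : Γ.rankMulOn N (ψ w) = Module.finrank ℝ (LinearMap.range (T w).toLinearMap) := by
      have h2 := congrArg (fun S : Submodule ℝ (EG × EG) =>
        S.map (Γ.tangentMul (ψ w) : EG × EG →L[ℝ] EG).toLinearMap) (hψT w hw.1.1)
      have h3 := LinearMap.range_comp
        (mfderiv 𝓘(ℝ, W) (𝓘(ℝ, EG).prod 𝓘(ℝ, EG)) ψ w : W →L[ℝ] EG × EG).toLinearMap
        (Γ.tangentMul (ψ w) : EG × EG →L[ℝ] EG).toLinearMap
      exact congrArg (fun S : Submodule ℝ EG => Module.finrank ℝ S) (h2.trans h3.symm)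
    rw [h1]
    have h4 : LinearMap.range ((D w).comp (T w)).toLinearMap =
        (LinearMap.range (T w).toLinearMap).map (D w).toLinearMap :=
      LinearMap.range_comp (T w).toLinearMap (D w).toLinearMap
    rw [h4]
    -- The chart has injective derivative, so reading the product in it does not change the rank.
    exact (Submodule.equivMapOfInjective (D w).toLinearMap
      (mfderiv_extend_injective hχ hw.2.2) _).finrank_eq.symm
  rw [hψT 0 h0] at hv
  obtain ⟨(u : W), rfl⟩ := hv
  have hker : fderiv ℝ f 0 u = 0 := by
    rw [hfd 0 h0₁]
    exact (congrArg (D 0) hm).trans (map_zero (D 0))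
  obtain ⟨δ, c, hδ, hc0, hcs, hcd, hcf⟩ :=
    exists_curve_in_fiber_of_constant_rank hΩ₁ hf h0₁ hrank hker
  refine mem_curveVelocities_iff.2 ⟨δ, fun t => ψ (c t), hδ,
    hψ.comp hcs.contMDiffOn fun t ht => (hcf t ht).1.1.1, fun t ht => ⟨hψS _ (hcf t ht).1.1.1, ?_⟩,
    (hasVelocity_iff_hasDerivAt.2 ⟨hc0, hcd⟩ : HasVelocity 𝓘(ℝ, W) c 0 u).comp_mdifferentiableAt
      ((hψ.contMDiffAt (hΩ.mem_nhds h0)).mdifferentiableAt (by simp))⟩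
  refine ((χ.extend 𝓘(ℝ, EG)).injOn ?_ ?_ (hcf t ht).2).trans hμ0
  · rw [χ.extend_source]; exact (hcf t ht).1.2.2
  · rw [χ.extend_source]; exact h0₁.2.2

end LieGroupoid

theorem theorem5p1
    {EG EQ : Type*} [NormedAddCommGroup EG] [NormedSpace ℝ EG] [FiniteDimensional ℝ EG]
    [NormedAddCommGroup EQ] [NormedSpace ℝ EQ] [FiniteDimensional ℝ EQ]
    {G Q : Type*} [TopologicalSpace G] [ChartedSpace EG G] [IsManifold 𝓘(ℝ, EG) ∞ G]
    [TopologicalSpace Q] [ChartedSpace EQ Q] [IsManifold 𝓘(ℝ, EQ) ∞ Q]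
    (Γ : LieGroupoid EG EQ G Q) (N : Set G) (g : G)
    (hN : IsEmbeddedSubmanifold 𝓘(ℝ, EG) N)
    (hN₂ : IsEmbeddedSubmanifold (𝓘(ℝ, EG).prod 𝓘(ℝ, EG)) (Γ.composableIn N))
    (hrank : ∃ U : Set (G × G), IsOpen U ∧ Γ.admissible N g ⊆ U ∧
      ∃ r : ℕ, ∀ p ∈ Γ.composableIn N ∩ U, Γ.rankMulOn N p = r)
    (g₁ g₂ : G) (hg : (g₁, g₂) ∈ Γ.admissible N g) (q : Q) (hq : Γ.tgt g₁ = q) :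
    (∃ e : Γ.algebroidSubspace N q g₁ g₂ ≃ₗ[ℝ] Γ.variations N g₁ g₂,
      ∀ v : Γ.algebroidSubspace N q g₁ g₂,
        (e v : TangentSpace (𝓘(ℝ, EG).prod 𝓘(ℝ, EG)) ((g₁, g₂) : G × G)) =
          (Γ.leftTranslate q g₁ v, -Γ.rightTranslate q g₂ v)) ∧
    (Γ.IntersectsCleanlyAt N g₁ g₂ →
      curveVelocities (𝓘(ℝ, EG).prod 𝓘(ℝ, EG)) (Γ.admissible N g) (g₁, g₂) =
        (Γ.variations N g₁ g₂ : Set (TangentSpace (𝓘(ℝ, EG).prod 𝓘(ℝ, EG))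
          ((g₁, g₂) : G × G)))) := by
  
  have h₁₂ : Γ.tgt g₁ = Γ.src g₂ := hg.1.1
  refine ⟨Γ.exists_equiv_variations N hq (h₁₂.symm.trans hq), fun hclean => ?_⟩
  obtain ⟨U, hU, hsub, r, hr⟩ := hrank
  refine (Γ.curveVelocities_admissible_subset N hg).antisymm fun v hv => ?_
  -- Cleanness enters only here, to make the variation tangent to `G₂ ∩ (N × N)`.
  exact Γ.mem_curveVelocities_admissible hN₂ hU hr hg (hsub hg) ((hclean v).2 hv.1) hv.2
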